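/- Let $d,n\ge 1$, let $p\ge 1$, let $\mathsf Y\subset\mathbb R^d$ be closed, let $\pi$ be a prior probability distribution on a measurable space $\Theta$, and let $(\mu_\theta)_{\theta\in\Theta}$ be a statistical model of probability measures on $\mathsf Y$, measurable in $\theta$, such that each $\mu_\theta$ has a density $f_\theta\ge 0$ with respect to Lebesgue measure on $\mathsf Y$ that is continuous on $\mathsf Y$. For $z_{1:n}=(z_1,\dots,z_n)\in\mathsf Y^n$ write $f_\theta(z_{1:n})=\prod_{i=1}^n f_\theta(z_i)$ for the density of $n$ i.i.d. draws from $\mu_\theta$. For data sets $y_{1:n},z_{1:n}$ let $$\mathrm{SW}_p^p(y_{1:n},z_{1:n})=\int_{\mathbb S^{d-1}} W_p^p\big(u^\star_\sharp\hat\mu_y,\,u^\star_\sharp\hat\mu_z\big)\,d\boldsymbol\sigma(u),$$ where $\hat\mu_y=\frac1n\sum_i\delta_{y_i}$ and $\hat\mu_z=\frac1n\sum_i\delta_{z_i}$ are the empirical distributions, $u^\star(x)=\langle u,x\rangle$, $\boldsymbol\sigma$ is the uniform distribution on the unit sphere, and $W_p^p(\mu,\nu)=\inf_\gamma\int|s-t|^p\,d\gamma(s,t)$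 over all couplings $\gamma$ of $\mu$ and $\nu$. Fix observed data $y_{1:n}\in\mathsf Y^n$ such that every ball around each $y_i$ meets $\mathsf Y$ in a set of positive Lebesgue measure (automatic, for instance, if $\mathsf Y=\mathbb R^d$) and such that $\int_\Theta f_\theta(y_{1:n})\,d\pi(\theta)>0$. Suppose there are a set $\mathcal N_\Theta\subset\Theta$ with $\pi(\mathcal N_\Theta)=0$ and a number $\bar\varepsilon>0$ with $$\sup_{\theta\in\Theta\setminus\mathcal N_\Theta} f_\theta(y_{1:n})<\infty,\qquad \sup_{\theta\in\Theta\setminus\mathcal N_\Theta}\ \sup_{z_{1:n}\in\mathsf A^{\bar\varepsilon}} f_\theta(z_{1:n})<\infty,\qquad \mathsf A^{\bar\varepsilon}=\{z_{1:n}\in\mathsf Y^n:\mathrm{SW}_p(y_{1:n},z_{1:n})\le\bar\varepsilon\}.$$ For $\varepsilon>0$ and measurable $B\subset\Theta$, define the SW-ABC posterior (with synthetic data sets of the same size $n$ as the observed one) and the exact posterior by $$\pi^\varepsilon_{y_{1:n}}(B)=\frac{\int_B \mu_\theta^{\otimes n}\{z_{1:n}:\mathrm{SW}_p(y_{1:n},z_{1:n})\le\varepsilon\}\,d\pi(\theta)}{\int_\Theta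 \mu_\theta^{\otimes n}\{z_{1:n}:\mathrm{SW}_p(y_{1:n},z_{1:n})\le\varepsilon\}\,d\pi(\theta)},\qquad \pi(B\mid y_{1:n})=\frac{\int_B f_\theta(y_{1:n})\,d\pi(\theta)}{\int_\Theta f_\theta(y_{1:n})\,d\pi(\theta)}.$$ Then $\pi(\cdot\mid y_{1:n})$ and, for every $\varepsilon>0$, $\pi^\varepsilon_{y_{1:n}}$ are well-defined probability measures, and for every measurable $B\subset\Theta$, $$\lim_{\varepsilon\to0^+}\pi^\varepsilon_{y_{1:n}}(B)=\pi(B\mid y_{1:n}).$$ -/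

import Mathlib

open MeasureTheory ProbabilityTheory Filter Topology
open scoped ENNReal NNReal

namespace SWABC

noncomputable section

/-- Transport plans between `μ` and `ν`: measures on the product with marginals `μ` and `ν`
(such a measure is automatically a probability measure when `μ` is). -/
def couplings {X : Type*} [MeasurableSpace X] (μ ν : Measure X) : Set (Measure (X × X)) :=
  {γ | γ.map Prod.fst = μ ∧ γ.map Prod.snd = ν}

/-- The `p`-th power `W_p^p(μ, ν)` of the Wasserstein distance of order `p`. -/
def wassersteinPow {X : Type*} [MeasurableSpace X] [PseudoEMetricSpace X]
    (p : ℝ) (μ ν : Measure X) : ℝ≥0∞ :=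
  ⨅ γ ∈ couplings μ ν, ∫⁻ z, edist z.1 z.2 ^ p ∂γ

/-- The uniform probability distribution on the unit sphere of `ℝ^d` (for `d ≥ 1`):
normalized surface measure. -/
def uniformSphere (d : ℕ) : Measure (Metric.sphere (0 : EuclideanSpace ℝ (Fin d)) 1) :=
  ((volume : Measure (EuclideanSpace ℝ (Fin d))).toSphere Set.univ)⁻¹ •
    (volume : Measure (EuclideanSpace ℝ (Fin d))).toSphere

/-- The Sliced-Wasserstein distance `SW_p(μ, ν)` of order `p` on `ℝ^d`: the `p`-th root of the
average over directions `u` of `W_p^p` between the push-forwards of `μ`, `ν` by `⟪u, ·⟫`. -/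
def slicedWasserstein {d : ℕ} (p : ℝ) (μ ν : Measure (EuclideanSpace ℝ (Fin d))) : ℝ≥0∞ :=
  (∫⁻ u, wassersteinPow p
      (μ.map fun x => inner ℝ (u : EuclideanSpace ℝ (Fin d)) x)
      (ν.map fun x => inner ℝ (u : EuclideanSpace ℝ (Fin d)) x) ∂(uniformSphere d)) ^ (1 / p)

/-- The empirical distribution `(1/n) ∑ δ_{x_i}` of a sample. -/
def empirical {X : Type*} [MeasurableSpace X] {n : ℕ} (x : Fin n → X) : Measure X :=
  (n : ℝ≥0∞)⁻¹ • ∑ i, Measure.dirac (x i)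

/-- The data discrepancy: `SW_p` between the empirical distributions of two data sets. -/
def dataSW {d n : ℕ} (p : ℝ) (y z : Fin n → EuclideanSpace ℝ (Fin d)) : ℝ≥0∞ :=
  slicedWasserstein p (empirical y) (empirical z)

/-- The probability that a synthetic data set `z_{1:n}` of `n` i.i.d. draws from `μ_θ` is
accepted, i.e. that `SW_p(y_{1:n}, z_{1:n}) ≤ ε`. -/
def acceptProb {d n : ℕ} {Θ : Type*} [MeasurableSpace Θ]
    (μ : Kernel Θ (EuclideanSpace ℝ (Fin d))) [IsMarkovKernel μ] (p : ℝ)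
    (y : Fin n → EuclideanSpace ℝ (Fin d)) (ε : ℝ) (θ : Θ) : ℝ≥0∞ :=
  Measure.pi (fun _ : Fin n => μ θ) {z | dataSW p y z ≤ ENNReal.ofReal ε}

/-- The probability distribution proportional to `w(θ) π(dθ)`, when the total weight is
neither zero nor infinite. -/
def reweight {Θ : Type*} [MeasurableSpace Θ] (π : Measure Θ) (w : Θ → ℝ≥0∞) : Measure Θ :=
  (∫⁻ θ, w θ ∂π)⁻¹ • π.withDensity w

/-- The SW-ABC posterior with tolerance `ε`: the prior reweighted by the acceptance
probability. -/
def swAbcPosterior {d n : ℕ} {Θ : Type*} [MeasurableSpace Θ] (π : Measure Θ)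
    (μ : Kernel Θ (EuclideanSpace ℝ (Fin d))) [IsMarkovKernel μ] (p : ℝ)
    (y : Fin n → EuclideanSpace ℝ (Fin d)) (ε : ℝ) : Measure Θ :=
  reweight π (acceptProb μ p y ε)

/-- The density `f_θ(z_{1:n}) = ∏ f_θ(z_i)` of a data set of `n` i.i.d. draws. -/
def likelihood {d n : ℕ} {Θ : Type*} (f : Θ → EuclideanSpace ℝ (Fin d) → ℝ≥0)
    (z : Fin n → EuclideanSpace ℝ (Fin d)) (θ : Θ) : ℝ≥0 :=
  ∏ i, f θ (z i)

/-- The exact posterior `π(· | y_{1:n})` given by Bayes' formula: the prior reweighted by the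
likelihood of the observed data. -/
def exactPosterior {d n : ℕ} {Θ : Type*} [MeasurableSpace Θ] (π : Measure Θ)
    (f : Θ → EuclideanSpace ℝ (Fin d) → ℝ≥0)
    (y : Fin n → EuclideanSpace ℝ (Fin d)) : Measure Θ :=
  reweight π (fun θ => (likelihood f y θ : ℝ≥0∞))

end

end SWABC

namespace SWABC

/-! Divided by the Lebesgue volume in `Y ^ n` of the acceptance set, the acceptance probability is
the average of the likelihood over that set. Reweighting ignores constant factors, so the SW-ABC
posterior is the prior reweighted by these averages (`reweight_const_mul`). As the tolerance tends
to zero, accepted data sets approach permutations of `y`; the likelihood is symmetric and continuous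
on `Y ^ n`, so the averages tend to its value at `y` (`tendsto_acceptProb`). The uniform bound on
the likelihood permits dominated convergence in numerator and denominator, and the limiting
denominator is neither zero nor infinite.

The geometric core is `exists_forall_dataSW_le_imp_dist_lt`. By Birkhoff's theorem a projected
Wasserstein cost is that of a best matching, but this matching varies with the direction `u`. If
every permutation `τ` displaces some point by at least `r`, in unit direction `v τ`, its projected
cost is at least `r ^ p * |⟪u, v τ⟫| ^ p` up to the factor `1 / n`. The product over all `τ` of the
inner-product factors, each at most 1, bounds them all from below at once, and its integral over `u`
has a positive lower bound uniform in `v` by compactness. -/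

lemma exists_perm_sum_le_of_mem_doublyStochastic {ι : Type*} [Fintype ι] [DecidableEq ι]
    {M : Matrix ι ι ℝ} (hM : M ∈ doublyStochastic ℝ ι) (C : ι → ι → ℝ) :
    ∃ τ : Equiv.Perm ι, ∑ i, C i (τ i) ≤ ∑ i, ∑ j, M i j * C i j := by
  -- Birkhoff: the cost of `M` is a weighted mean of permutation costs, and some permutation does
  -- not exceed the mean.
  obtain ⟨w, hw0, hw1, rfl⟩ := exists_eq_sum_perm_of_mem_doublyStochastic hM
  have key : ∑ i, ∑ j, (∑ σ, w σ • σ.permMatrix ℝ) i j * C i j =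
      ∑ σ, w σ * ∑ i, C i (σ i) := by
    have h1 : ∀ i, ∑ j, (∑ σ, w σ • σ.permMatrix ℝ) i j * C i j = ∑ σ, w σ * C i (σ i) := by
      intro i
      simp_rw [Matrix.sum_apply, Finset.sum_mul]
      rw [Finset.sum_comm]
      refine Finset.sum_congr rfl fun σ _ => ?_
      rw [Finset.sum_eq_single (σ i)]
      · simp [Equiv.Perm.permMatrix, PEquiv.toMatrix_apply]
      · intro j _ hj
        simp [Equiv.Perm.permMatrix, PEquiv.toMatrix_apply, hj.symm]
      · simp
    simp_rw [h1, Finset.mul_sum]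
    exact Finset.sum_comm
  rw [key]
  by_contra! h
  obtain ⟨σ, hσ⟩ : ∃ σ, 0 < w σ := by
    by_contra! h0
    have : ∑ σ, w σ ≤ 0 := Finset.sum_nonpos fun σ _ => h0 σ
    linarith
  have hlt : (∑ σ, w σ * ∑ σ', w σ' * ∑ i, C i (σ' i)) < ∑ σ, w σ * ∑ i, C i (σ i) :=
    Finset.sum_lt_sum (fun σ _ => mul_le_mul_of_nonneg_left (h σ).le (hw0 σ))
      ⟨σ, Finset.mem_univ _, mul_lt_mul_of_pos_left (h σ) hσ⟩
  rw [← Finset.sum_mul, hw1, one_mul] at hlt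
  exact lt_irrefl _ hlt

lemma exists_perm_sum_le_of_sum_eq_one {ι : Type*} [Fintype ι] [DecidableEq ι]
    (M C : ι → ι → ℝ≥0∞) (hrow : ∀ i, ∑ j, M i j = 1) (hcol : ∀ j, ∑ i, M i j = 1)
    (hC : ∀ i j, C i j ≠ ∞) :
    ∃ τ : Equiv.Perm ι, ∑ i, C i (τ i) ≤ ∑ i, ∑ j, M i j * C i j := by
  have hM : ∀ i j, M i j ≠ ∞ := fun i j =>
    ne_top_of_le_ne_top ENNReal.one_ne_top
      ((Finset.single_le_sum (f := fun j => M i j) (fun _ _ => zero_le)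
        (Finset.mem_univ j)).trans (hrow i).le)
  obtain ⟨τ, hτ⟩ := exists_perm_sum_le_of_mem_doublyStochastic
    (M := Matrix.of fun i j => (M i j).toReal)
    (mem_doublyStochastic_iff_sum.2 ⟨fun i j => ENNReal.toReal_nonneg,
      fun i => by simp [← ENNReal.toReal_sum (fun j _ => hM i j), hrow],
      fun j => by simp [← ENNReal.toReal_sum (fun i _ => hM i j), hcol]⟩)
    (fun i j => (C i j).toReal)
  refine ⟨τ, ?_⟩
  have hMC : ∀ i j, M i j * C i j ≠ ∞ := fun i j => ENNReal.mul_ne_top (hM i j) (hC i j)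
  rw [← ENNReal.toReal_le_toReal (ENNReal.sum_ne_top.2 fun i _ => hC _ _)
    (ENNReal.sum_ne_top.2 fun i _ => ENNReal.sum_ne_top.2 fun j _ => hMC i j),
    ENNReal.toReal_sum (fun i _ => hC _ _),
    ENNReal.toReal_sum (fun i _ => ENNReal.sum_ne_top.2 fun j _ => hMC i j)]
  simp_rw [fun i => ENNReal.toReal_sum (fun j (_ : j ∈ Finset.univ) => hMC i j), ENNReal.toReal_mul]
  simpa using hτ

/-! ### Couplings of empirical distributions -/

section Share

variable {X : Type*} {n : ℕ}

open Classical in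
/-- The share of the index `i` among the indices whose sample point sits at `s`. -/
noncomputable def share (a : Fin n → X) (i : Fin n) (s : X) : ℝ≥0∞ :=
  if s = a i then ((Finset.univ.filter fun k => a k = a i).card : ℝ≥0∞)⁻¹ else 0

lemma card_fiber_ne_zero [DecidableEq X] (a : Fin n → X) (i : Fin n) :
    ((Finset.univ.filter fun k => a k = a i).card : ℝ≥0∞) ≠ 0 := by
  rw [Nat.cast_ne_zero]
  exact (Finset.card_pos.2 ⟨i, by simp⟩).ne'

/-- Sample points may coincide, so indicators of the points would overcount; dividing by
multiplicity gives a partition of unity on the sample. -/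
lemma sum_share (a : Fin n → X) {s : X} (hs : s ∈ Set.range a) : ∑ i, share a i s = 1 := by
  classical
  obtain ⟨k, rfl⟩ := hs
  have : ∀ i, share a i (a k) =
      if a i = a k then ((Finset.univ.filter fun k' => a k' = a k).card : ℝ≥0∞)⁻¹ else 0 := by
    intro i
    unfold share
    by_cases h : a i = a k
    · simp [h]
    · simp [h, Ne.symm h]
  simp_rw [this]
  rw [← Finset.sum_filter, Finset.sum_const, nsmul_eq_mul]
  exact ENNReal.mul_inv_cancel (card_fiber_ne_zero a k) (ENNReal.natCast_ne_top _)

lemma sum_share_apply (a : Fin n → X) (i : Fin n) : ∑ k, share a i (a k) = 1 := by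
  classical
  unfold share
  rw [← Finset.sum_filter, Finset.sum_const, nsmul_eq_mul]
  convert ENNReal.mul_inv_cancel (card_fiber_ne_zero a i) (ENNReal.natCast_ne_top _)

lemma measurable_share [MeasurableSpace X] [MeasurableSingletonClass X] (a : Fin n → X)
    (i : Fin n) : Measurable (share a i) := by
  classical
  exact Measurable.ite (measurableSet_singleton (a i)) measurable_const measurable_const

variable [MeasurableSpace X]

lemma lintegral_empirical [MeasurableSingletonClass X] (a : Fin n → X) (g : X → ℝ≥0∞) :
    ∫⁻ s, g s ∂(empirical a) = (n : ℝ≥0∞)⁻¹ * ∑ i, g (a i) := by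
  rw [empirical, lintegral_smul_measure, lintegral_finsetSum_measure]
  simp

lemma ae_mem_range_empirical [MeasurableSingletonClass X] (a : Fin n → X) :
    ∀ᵐ s ∂(empirical a), s ∈ Set.range a := by
  rw [ae_iff, empirical, Measure.smul_apply, Measure.finsetSum_apply]
  have hm : MeasurableSet {s | s ∉ Set.range a} := (Set.finite_range a).measurableSet.compl
  rw [Finset.sum_eq_zero]
  · simp
  · intro i _
    rw [Measure.dirac_apply' _ hm]
    simp

lemma map_empirical {Z : Type*} [MeasurableSpace Z] {g : X → Z} (hg : Measurable g)
    (a : Fin n → X) : (empirical a).map g = empirical fun i => g (a i) := by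
  ext s hs
  simp [empirical, Measure.map_apply hg hs, Measure.dirac_apply' _ hs,
    Measure.dirac_apply' _ (hg hs), Set.indicator]
  rfl

end Share

/-- The optimal transport cost between two empirical distributions of the same size is the cost
of the best matching. -/
lemma wassersteinPow_empirical {X : Type*} [MeasurableSpace X] [MeasurableSingletonClass X]
    [PseudoMetricSpace X] {n : ℕ} (hn : 1 ≤ n) {p : ℝ} (hp : 0 ≤ p) (a b : Fin n → X) :
    wassersteinPow p (empirical a) (empirical b) =
      (n : ℝ≥0∞)⁻¹ * ⨅ τ : Equiv.Perm (Fin n), ∑ i, edist (a i) (b (τ i)) ^ p := by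
  have hn0 : (n : ℝ≥0∞) ≠ 0 := by
    rw [Nat.cast_ne_zero]; omega
  have hnt : (n : ℝ≥0∞) ≠ ∞ := ENNReal.natCast_ne_top _
  apply le_antisymm
  · rw [ENNReal.mul_iInf_of_ne (by simp) (by simpa using hn0)]
    refine le_iInf fun τ => ?_
    -- A matching is the coupling that is uniform on the matched pairs.
    refine (iInf₂_le (empirical fun i => (a i, b (τ i)))
      ⟨map_empirical measurable_fst _, ?_⟩).trans (lintegral_empirical _ _).le
    rw [map_empirical measurable_snd]
    simp only [empirical]
    rw [Equiv.sum_comp τ fun i => Measure.dirac (b i)]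
  · refine le_iInf₂ fun γ hγ => ?_
    have hfst : Measure.map Prod.fst γ = empirical a := hγ.1
    have hsnd : Measure.map Prod.snd γ = empirical b := hγ.2
    have hae1 : ∀ᵐ z ∂γ, z.1 ∈ Set.range a :=
      ae_of_ae_map measurable_fst.aemeasurable (hfst ▸ ae_mem_range_empirical a)
    have hae2 : ∀ᵐ z ∂γ, z.2 ∈ Set.range b :=
      ae_of_ae_map measurable_snd.aemeasurable (hsnd ▸ ae_mem_range_empirical b)
    have hm1 : ∀ i, Measurable fun z : X × X => share a i z.1 :=
      fun i => (measurable_share a i).comp measurable_fst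
    have hm2 : ∀ j, Measurable fun z : X × X => share b j z.2 :=
      fun j => (measurable_share b j).comp measurable_snd
    have hm12 : ∀ i j, Measurable fun z : X × X => share a i z.1 * share b j z.2 :=
      fun i j => (hm1 i).mul (hm2 j)
    -- The mass of `γ` is split among index pairs by shares; the factor `n` makes the matrix doubly
    -- stochastic.
    set M : Fin n → Fin n → ℝ≥0∞ :=
      fun i j => n * ∫⁻ z, share a i z.1 * share b j z.2 ∂γ with hMdef
    have hrow : ∀ i, ∑ j, M i j = 1 := by
      intro i
      simp only [hMdef]
      rw [← Finset.mul_sum, ← lintegral_finsetSum _ fun j _ => hm12 i j]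
      have : ∫⁻ z, ∑ j, share a i z.1 * share b j z.2 ∂γ = ∫⁻ z, share a i z.1 ∂γ := by
        refine lintegral_congr_ae ?_
        filter_upwards [hae2] with z hz
        rw [← Finset.mul_sum, sum_share b hz, mul_one]
      rw [this, ← lintegral_map (measurable_share a i) measurable_fst, hfst, lintegral_empirical,
        sum_share_apply, mul_one, ENNReal.mul_inv_cancel hn0 hnt]
    have hcol : ∀ j, ∑ i, M i j = 1 := by
      intro j
      simp only [hMdef]
      rw [← Finset.mul_sum, ← lintegral_finsetSum _ fun i _ => hm12 i j]
      have : ∫⁻ z, ∑ i, share a i z.1 * share b j z.2 ∂γ = ∫⁻ z, share b j z.2 ∂γ := by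
        refine lintegral_congr_ae ?_
        filter_upwards [hae1] with z hz
        rw [← Finset.sum_mul, sum_share a hz, one_mul]
      rw [this, ← lintegral_map (measurable_share b j) measurable_snd, hsnd, lintegral_empirical,
        sum_share_apply, mul_one, ENNReal.mul_inv_cancel hn0 hnt]
    obtain ⟨τ, hτ⟩ := exists_perm_sum_le_of_sum_eq_one M
      (fun i j => edist (a i) (b j) ^ p) hrow hcol
      (fun i j => ENNReal.rpow_ne_top_of_nonneg hp (edist_ne_top _ _))
    have hcost : ∑ i, ∑ j, M i j * edist (a i) (b j) ^ p = n * ∫⁻ z, edist z.1 z.2 ^ p ∂γ := by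
      have h1 : ∫⁻ z, edist z.1 z.2 ^ p ∂γ = ∫⁻ z, ∑ i, ∑ j,
          share a i z.1 * share b j z.2 * edist (a i) (b j) ^ p ∂γ := by
        refine lintegral_congr_ae ?_
        filter_upwards [hae1, hae2] with z hz1 hz2
        have h2 : ∀ i j, share a i z.1 * share b j z.2 * edist (a i) (b j) ^ p =
            share a i z.1 * share b j z.2 * edist z.1 z.2 ^ p := by
          intro i j
          by_cases hi : z.1 = a i
          · by_cases hj : z.2 = b j
            · rw [hi, hj]
            · simp [share, hj]
          · simp [share, hi]
        simp_rw [h2, ← Finset.sum_mul, ← Finset.mul_sum, ← Finset.sum_mul]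
        rw [sum_share a hz1, sum_share b hz2, one_mul, one_mul]
      rw [h1, lintegral_finsetSum _ fun i _ => Finset.measurable_fun_sum _ fun j _ =>
        (hm12 i j).mul_const _, Finset.mul_sum]
      refine Finset.sum_congr rfl fun i _ => ?_
      rw [lintegral_finsetSum _ fun j _ => (hm12 i j).mul_const _, Finset.mul_sum]
      refine Finset.sum_congr rfl fun j _ => ?_
      rw [lintegral_mul_const _ (hm12 i j), mul_assoc]
    rw [hcost] at hτ
    calc _ ≤ (n : ℝ≥0∞)⁻¹ * (n * ∫⁻ z, edist z.1 z.2 ^ p ∂γ) := by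
          gcongr
          exact (iInf_le _ τ).trans hτ
      _ = _ := by rw [← mul_assoc, ENNReal.inv_mul_cancel hn0 hnt, one_mul]

/-- The integral is continuous in `v`, by domination by 1, so it attains its minimum on the compact
space; there the integrand is positive a.e. for a nonzero measure. -/
lemma exists_pos_le_lintegral_of_continuous {X α : Type*} [TopologicalSpace X] [CompactSpace X]
    [Nonempty X] [FirstCountableTopology X] [TopologicalSpace α] [SecondCountableTopology α]
    [MeasurableSpace α] [OpensMeasurableSpace α] {ν : Measure α} [IsFiniteMeasure ν] (hν : ν ≠ 0)
    {F : X → α → ℝ} (hF : Continuous fun q : X × α => F q.1 q.2) (hF0 : ∀ v u, 0 ≤ F v u)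
    (hF1 : ∀ v u, F v u ≤ 1) (hpos : ∀ v, ∀ᵐ u ∂ν, 0 < F v u) :
    ∃ c : ℝ≥0∞, 0 < c ∧ ∀ v, c ≤ ∫⁻ u, ENNReal.ofReal (F v u) ∂ν := by
  have hFu : ∀ v, Continuous (F v) := fun v => hF.comp (Continuous.prodMk_right v)
  have hFn : ∀ v u, ‖F v u‖ ≤ 1 := fun v u => by
    rw [Real.norm_of_nonneg (hF0 v u)]; exact hF1 v u
  have hint : ∀ v, Integrable (F v) ν := fun v =>
    Integrable.of_bound (hFu v).aestronglyMeasurable 1 (Eventually.of_forall (hFn v))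
  have hK : Continuous fun v => ∫ u, F v u ∂ν :=
    continuous_of_dominated (bound := fun _ => 1)
      (fun v => (hFu v).aestronglyMeasurable)
      (fun v => Eventually.of_forall (hFn v)) (integrable_const _)
      (Eventually.of_forall fun u => hF.comp (Continuous.prodMk_left u))
  obtain ⟨v₀, -, hv₀⟩ := isCompact_univ.exists_isMinOn Set.univ_nonempty hK.continuousOn
  refine ⟨ENNReal.ofReal (∫ u, F v₀ u ∂ν), ?_, fun v => ?_⟩
  · rw [ENNReal.ofReal_pos]
    refine lt_of_le_of_ne (integral_nonneg (hF0 v₀)) fun h => ?_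
    have h0 := (integral_eq_zero_iff_of_nonneg (hF0 v₀) (hint v₀)).1 h.symm
    have : ∀ᵐ u ∂ν, False := by
      filter_upwards [h0, hpos v₀] with u hu0 hu1
      exact hu1.ne' hu0
    rw [eventually_false_iff_eq_bot, ae_eq_bot] at this
    exact hν this
  · rw [← ofReal_integral_eq_lintegral_ofReal (hint v) (Eventually.of_forall (hF0 v))]
    exact ENNReal.ofReal_le_ofReal (isMinOn_iff.1 hv₀ v (Set.mem_univ _))

/-! ### Uniform directions on the sphere -/

section Sphere

lemma uniformSphere_univ_le_one (d : ℕ) : uniformSphere d Set.univ ≤ 1 := by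
  rw [uniformSphere, Measure.smul_apply, smul_eq_mul]
  exact ENNReal.inv_mul_le_one _

instance (d : ℕ) : IsFiniteMeasure (uniformSphere d) :=
  ⟨(uniformSphere_univ_le_one d).trans_lt ENNReal.one_lt_top⟩

lemma uniformSphere_ne_zero {d : ℕ} (hd : 1 ≤ d) : uniformSphere d ≠ 0 := by
  have : Nonempty (Fin d) := ⟨⟨0, hd⟩⟩
  have : Nontrivial (EuclideanSpace ℝ (Fin d)) := inferInstance
  intro h
  have h1 : uniformSphere d Set.univ = 0 := by rw [h]; rfl
  rw [uniformSphere, Measure.smul_apply, smul_eq_mul, ENNReal.inv_mul_cancel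
    (Measure.measure_univ_ne_zero.2 (Measure.toSphere_ne_zero _)) (measure_ne_top _ _)] at h1
  exact one_ne_zero h1

open scoped Pointwise in
-- Surface measure is computed from the volume of the cone over a set, and this cone lies in the
-- null hyperplane orthogonal to `v`.
lemma ae_inner_ne_zero {d : ℕ} {v : EuclideanSpace ℝ (Fin d)} (hv : v ≠ 0) :
    ∀ᵐ u : Metric.sphere (0 : EuclideanSpace ℝ (Fin d)) 1 ∂(uniformSphere d),
      inner ℝ (u : EuclideanSpace ℝ (Fin d)) v ≠ 0 := by
  rw [ae_iff, uniformSphere, Measure.smul_apply, smul_eq_mul]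
  simp only [ne_eq, not_not]
  have hm : MeasurableSet {u : Metric.sphere (0 : EuclideanSpace ℝ (Fin d)) 1 |
      inner ℝ (u : EuclideanSpace ℝ (Fin d)) v = 0} :=
    (isClosed_eq (by fun_prop) continuous_const).measurableSet
  rw [Measure.toSphere_apply' _ hm]
  have h0 : volume (Set.Ioo (0 : ℝ) 1 • ((↑) '' {u : Metric.sphere (0 : EuclideanSpace ℝ (Fin d)) 1 |
      inner ℝ (u : EuclideanSpace ℝ (Fin d)) v = 0} : Set (EuclideanSpace ℝ (Fin d)))) = 0 := by
    refine measure_mono_null ?_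
      (Measure.addHaar_submodule volume (LinearMap.ker (innerSL ℝ v).toLinearMap) ?_)
    · rintro _ ⟨r, -, _, ⟨u, hu, rfl⟩, rfl⟩
      have hu' : inner ℝ v (u : EuclideanSpace ℝ (Fin d)) = 0 := by
        rw [real_inner_comm]; exact hu
      simp [hu']
    · intro h
      have : v ∈ LinearMap.ker (innerSL ℝ v).toLinearMap := h ▸ Submodule.mem_top
      simp [hv] at this
  rw [h0, mul_zero, mul_zero]

lemma exists_pos_le_lintegral_prod_inner {d : ℕ} (hd : 1 ≤ d) (ι : Type*) [Fintype ι]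
    {p : ℝ} (hp : 0 < p) :
    ∃ c : ℝ≥0∞, 0 < c ∧ ∀ v : ι → Metric.sphere (0 : EuclideanSpace ℝ (Fin d)) 1,
      c ≤ ∫⁻ u, ∏ i, ENNReal.ofReal |inner ℝ (u : EuclideanSpace ℝ (Fin d)) (v i)| ^ p
        ∂(uniformSphere d) := by
  have : Nonempty (Fin d) := ⟨⟨0, hd⟩⟩
  have : Nonempty (Metric.sphere (0 : EuclideanSpace ℝ (Fin d)) 1) :=
    (NormedSpace.sphere_nonempty.2 zero_le_one).to_subtype
  obtain ⟨c, hc, hcF⟩ := exists_pos_le_lintegral_of_continuous (uniformSphere_ne_zero hd)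
    (F := fun (v : ι → Metric.sphere (0 : EuclideanSpace ℝ (Fin d)) 1)
      (u : Metric.sphere (0 : EuclideanSpace ℝ (Fin d)) 1) =>
      ∏ i, |inner ℝ (u : EuclideanSpace ℝ (Fin d)) (v i)| ^ p)
    (by
      refine continuous_finsetProd _ fun i _ => Continuous.rpow_const ?_ fun _ => Or.inr hp.le
      have h1 : Continuous fun q : (ι → Metric.sphere (0 : EuclideanSpace ℝ (Fin d)) 1) ×
          Metric.sphere (0 : EuclideanSpace ℝ (Fin d)) 1 => (q.1 i : EuclideanSpace ℝ (Fin d)) :=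
        continuous_subtype_val.comp ((continuous_apply i).comp continuous_fst)
      exact ((continuous_subtype_val.comp continuous_snd).inner h1).abs)
    (fun v u => Finset.prod_nonneg fun i _ => Real.rpow_nonneg (abs_nonneg _) _)
    (fun v u => by
      refine Finset.prod_le_one (fun i _ => Real.rpow_nonneg (abs_nonneg _) _) fun i _ => ?_
      refine Real.rpow_le_one (abs_nonneg _) ((abs_real_inner_le_norm _ _).trans ?_) hp.le
      simp)
    (fun v => by
      filter_upwards [ae_all_iff.2 fun i => ae_inner_ne_zero (ne_zero_of_mem_unit_sphere (v i))]
        with u hu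
      exact Finset.prod_pos fun i _ => Real.rpow_pos_of_pos (abs_pos.2 (hu i)) _)
  refine ⟨c, hc, fun v => (hcF v).trans (lintegral_mono fun u => ?_)⟩
  rw [ENNReal.ofReal_prod_of_nonneg fun i _ => Real.rpow_nonneg (abs_nonneg _) _]
  refine (Finset.prod_congr rfl fun i _ => ?_).le
  rw [ENNReal.ofReal_rpow_of_nonneg (abs_nonneg _) hp.le]

end Sphere

/-! ### Sliced-Wasserstein distance versus matched pointwise distance -/

variable {d n : ℕ}

/-- With a minimum over finitely many permutations in place of all couplings, measurability in `z`
and explicit bounds become accessible. -/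
lemma dataSW_eq (hn : 1 ≤ n) {p : ℝ} (hp : 1 ≤ p) (y z : Fin n → EuclideanSpace ℝ (Fin d)) :
    dataSW p y z = (∫⁻ u, (n : ℝ≥0∞)⁻¹ * ⨅ τ : Equiv.Perm (Fin n), ∑ i,
      edist (inner ℝ (u : EuclideanSpace ℝ (Fin d)) (y i))
        (inner ℝ (u : EuclideanSpace ℝ (Fin d)) (z (τ i))) ^ p ∂(uniformSphere d)) ^ (1 / p) := by
  unfold dataSW slicedWasserstein
  congr 1
  refine lintegral_congr fun u => ?_
  rw [map_empirical (by fun_prop), map_empirical (by fun_prop),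
    wassersteinPow_empirical hn (by linarith)]

lemma measurable_dataSW (hn : 1 ≤ n) {p : ℝ} (hp : 1 ≤ p)
    (y : Fin n → EuclideanSpace ℝ (Fin d)) : Measurable (dataSW p y) := by
  rw [show dataSW p y = _ from funext fun z => dataSW_eq hn hp y z]
  refine Measurable.pow_const (Measurable.lintegral_prod_right' (f := fun q :
    (Fin n → EuclideanSpace ℝ (Fin d)) × Metric.sphere (0 : EuclideanSpace ℝ (Fin d)) 1 =>
      (n : ℝ≥0∞)⁻¹ * ⨅ τ : Equiv.Perm (Fin n), ∑ i,
      edist (inner ℝ (q.2 : EuclideanSpace ℝ (Fin d)) (y i))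
        (inner ℝ (q.2 : EuclideanSpace ℝ (Fin d)) (q.1 (τ i))) ^ p) ?_) _
  refine Measurable.const_mul (Measurable.iInf fun τ =>
    Finset.measurable_fun_sum _ fun i _ => Measurable.pow_const (Continuous.measurable ?_) _) _
  fun_prop

lemma edist_inner_le (u : Metric.sphere (0 : EuclideanSpace ℝ (Fin d)) 1)
    (x z : EuclideanSpace ℝ (Fin d)) :
    edist (inner ℝ (u : EuclideanSpace ℝ (Fin d)) x)
      (inner ℝ (u : EuclideanSpace ℝ (Fin d)) z) ≤ edist x z := by
  rw [edist_dist, edist_dist]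
  refine ENNReal.ofReal_le_ofReal ?_
  rw [Real.dist_eq, ← inner_sub_right, dist_eq_norm]
  refine (abs_real_inner_le_norm _ _).trans ?_
  simp

/-- Pointwise close data sets are close in the Sliced-Wasserstein distance. -/
lemma dataSW_le_of_forall_dist_le (hn : 1 ≤ n) {p : ℝ} (hp : 1 ≤ p)
    {y z : Fin n → EuclideanSpace ℝ (Fin d)} {ε : ℝ} (h : ∀ i, dist (z i) (y i) ≤ ε) :
    dataSW p y z ≤ ENNReal.ofReal ε := by
  have hp0 : 0 < p := by linarith
  rw [dataSW_eq hn hp, one_div, ENNReal.rpow_inv_le_iff hp0]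
  calc _ ≤ ∫⁻ _, ENNReal.ofReal ε ^ p ∂(uniformSphere d) := by
        refine lintegral_mono fun u => ?_
        have : ⨅ τ : Equiv.Perm (Fin n), ∑ i,
            edist (inner ℝ (u : EuclideanSpace ℝ (Fin d)) (y i))
              (inner ℝ (u : EuclideanSpace ℝ (Fin d)) (z (τ i))) ^ p ≤
            n * ENNReal.ofReal ε ^ p := by
          refine (iInf_le _ 1).trans ((Finset.sum_le_sum (g := fun _ => ENNReal.ofReal ε ^ p)
            fun i _ => ?_).trans ?_)
          · gcongr
            refine (edist_inner_le u _ _).trans ?_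
            rw [edist_comm, edist_dist]
            exact ENNReal.ofReal_le_ofReal (h i)
          · simp
        refine (mul_le_mul_right this _).trans ?_
        rw [← mul_assoc]
        exact (mul_le_mul_left (ENNReal.inv_mul_le_one _) _).trans (one_mul _).le
    _ ≤ ENNReal.ofReal ε ^ p := by
        rw [lintegral_const]
        exact (mul_le_mul_right (uniformSphere_univ_le_one d) _).trans (mul_one _).le

/-- Data sets that are close in the Sliced-Wasserstein distance are pointwise close up to a
permutation. -/
lemma exists_forall_dataSW_le_imp_dist_lt (hd : 1 ≤ d) (hn : 1 ≤ n) {p : ℝ} (hp : 1 ≤ p)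
    (y : Fin n → EuclideanSpace ℝ (Fin d)) {r : ℝ} (hr : 0 < r) :
    ∃ ε > (0 : ℝ), ∀ z, dataSW p y z ≤ ENNReal.ofReal ε →
      ∃ τ : Equiv.Perm (Fin n), ∀ i, dist (z (τ i)) (y i) < r := by
  have hp0 : 0 < p := by linarith
  obtain ⟨c, hc, hcv⟩ := exists_pos_le_lintegral_prod_inner hd (Equiv.Perm (Fin n)) hp0
  have hD : 0 < ((n : ℝ≥0∞)⁻¹ * (ENNReal.ofReal r ^ p * c)) ^ (1 / p) := by
    refine ENNReal.rpow_pos_of_nonneg ?_ (by positivity)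
    refine ENNReal.mul_pos (by simp) (mul_ne_zero ?_ hc.ne')
    exact (ENNReal.rpow_pos (ENNReal.ofReal_pos.2 hr) ENNReal.ofReal_ne_top).ne'
  -- The tolerance `q` lies strictly below a bound that `dataSW p y z` reaches whenever every
  -- permutation has an index at distance at least `r`.
  obtain ⟨q, hq0, hqD⟩ := ENNReal.lt_iff_exists_nnreal_btwn.1 hD
  refine ⟨q, by exact_mod_cast hq0, fun z hz => ?_⟩
  by_contra! hfar
  choose j hj using hfar
  have hne : ∀ τ, y (j τ) - z (τ (j τ)) ≠ 0 := fun τ h => by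
    have := hj τ
    rw [dist_comm, dist_eq_norm, h, norm_zero] at this
    linarith
  refine absurd hz (not_le.2 ?_)
  rw [ENNReal.ofReal_coe_nnreal]
  refine hqD.trans_le ?_
  rw [dataSW_eq hn hp]
  refine ENNReal.rpow_le_rpow ?_ (by positivity)
  let v : Equiv.Perm (Fin n) → Metric.sphere (0 : EuclideanSpace ℝ (Fin d)) 1 := fun τ =>
    ⟨‖y (j τ) - z (τ (j τ))‖⁻¹ • (y (j τ) - z (τ (j τ))), by
      rw [mem_sphere_zero_iff_norm]; exact norm_smul_inv_norm (𝕜 := ℝ) (hne τ)⟩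
  have hle1 : ∀ (u : Metric.sphere (0 : EuclideanSpace ℝ (Fin d)) 1) τ,
      ENNReal.ofReal |inner ℝ (u : EuclideanSpace ℝ (Fin d)) (v τ)| ^ p ≤ 1 := fun u τ => by
    refine ENNReal.rpow_le_one ?_ hp0.le
    rw [ENNReal.ofReal_le_one]
    refine (abs_real_inner_le_norm _ _).trans ?_
    simp
  -- The product does not involve the permutation chosen by the infimum, so it can be integrated
  -- over `u`.
  have hpt : ∀ u : Metric.sphere (0 : EuclideanSpace ℝ (Fin d)) 1,
      ENNReal.ofReal r ^ p *
        ∏ τ, ENNReal.ofReal |inner ℝ (u : EuclideanSpace ℝ (Fin d)) (v τ)| ^ p ≤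
      ⨅ τ : Equiv.Perm (Fin n), ∑ i, edist (inner ℝ (u : EuclideanSpace ℝ (Fin d)) (y i))
        (inner ℝ (u : EuclideanSpace ℝ (Fin d)) (z (τ i))) ^ p := by
    refine fun u => le_iInf fun τ => ?_
    calc _ ≤ ENNReal.ofReal r ^ p *
          ENNReal.ofReal |inner ℝ (u : EuclideanSpace ℝ (Fin d)) (v τ)| ^ p := by
          gcongr
          rw [← Finset.mul_prod_erase _ _ (Finset.mem_univ τ)]
          exact (mul_le_mul_right (Finset.prod_le_one' fun τ _ => hle1 u τ) _).trans
            (mul_one _).le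
      _ ≤ edist (inner ℝ (u : EuclideanSpace ℝ (Fin d)) (y (j τ)))
            (inner ℝ (u : EuclideanSpace ℝ (Fin d)) (z (τ (j τ)))) ^ p := by
          rw [← ENNReal.mul_rpow_of_nonneg _ _ hp0.le]
          refine ENNReal.rpow_le_rpow ?_ hp0.le
          rw [← ENNReal.ofReal_mul hr.le, edist_dist]
          refine ENNReal.ofReal_le_ofReal ?_
          rw [Real.dist_eq, ← inner_sub_right]
          have hnorm : 0 < ‖y (j τ) - z (τ (j τ))‖ := norm_pos_iff.2 (hne τ)
          have hr' : r ≤ ‖y (j τ) - z (τ (j τ))‖ := by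
            rw [← dist_eq_norm, dist_comm]; exact hj τ
          simp only [v, real_inner_smul_right, abs_mul, abs_inv, abs_norm]
          calc _ ≤ ‖y (j τ) - z (τ (j τ))‖ * (‖y (j τ) - z (τ (j τ))‖⁻¹ *
                |inner ℝ (u : EuclideanSpace ℝ (Fin d)) (y (j τ) - z (τ (j τ)))|) := by
                gcongr
            _ = _ := by rw [← mul_assoc, mul_inv_cancel₀ hnorm.ne', one_mul]
      _ ≤ _ := Finset.single_le_sum (f := fun i =>
            edist (inner ℝ (u : EuclideanSpace ℝ (Fin d)) (y i))
              (inner ℝ (u : EuclideanSpace ℝ (Fin d)) (z (τ i))) ^ p)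
            (fun _ _ => zero_le) (Finset.mem_univ (j τ))
  have hrt : ENNReal.ofReal r ^ p ≠ ∞ :=
    ENNReal.rpow_ne_top_of_nonneg hp0.le ENNReal.ofReal_ne_top
  have hnt : (n : ℝ≥0∞)⁻¹ ≠ ∞ := by
    rw [ENNReal.inv_ne_top, Nat.cast_ne_zero]; omega
  rw [lintegral_const_mul' _ _ hnt]
  gcongr
  calc _ ≤ ENNReal.ofReal r ^ p * ∫⁻ u, ∏ τ,
        ENNReal.ofReal |inner ℝ (u : EuclideanSpace ℝ (Fin d)) (v τ)| ^ p
          ∂(uniformSphere d) := by gcongr; exact hcv v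
    _ ≤ _ := by
        rw [← lintegral_const_mul' _ _ hrt]
        exact lintegral_mono hpt

/-! ### Product measures, densities and kernels -/

section Product

lemma lintegral_prod_pi {n : ℕ} {E : Type*} [MeasurableSpace E] (ν : Fin n → Measure E)
    [∀ i, SigmaFinite (ν i)] {f : Fin n → E → ℝ≥0∞} (hf : ∀ i, AEMeasurable (f i) (ν i)) :
    ∫⁻ x : Fin n → E, ∏ i, f i (x i) ∂(Measure.pi ν) = ∏ i, ∫⁻ x, f i x ∂(ν i) := by
  induction n with
  | zero => simp
  | succ n ih =>
    have hm := (measurePreserving_piFinSuccAbove ν 0).symm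
    have htail : AEMeasurable (fun x : Fin n → E => ∏ i : Fin n, f i.succ (x i))
        (Measure.pi fun i => ν i.succ) :=
      Finset.aemeasurable_fun_prod _ fun i _ =>
        (hf i.succ).comp_quasiMeasurePreserving
          (Measure.quasiMeasurePreserving_eval (μ := fun i : Fin n => ν i.succ) i)
    calc _ = ∫⁻ x : E × (Fin n → E), f 0 x.1 * ∏ i : Fin n, f i.succ (x.2 i)
            ∂((ν 0).prod (Measure.pi fun i => ν i.succ)) := by
          rw [← hm.map_eq, lintegral_map_equiv]
          simp_rw [MeasurableEquiv.piFinSuccAbove_symm_apply, Fin.insertNthEquiv,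
            Fin.prod_univ_succ, Fin.insertNth_zero, Equiv.coe_fn_mk, Fin.cons_succ,
            Fin.zero_succAbove, Fin.cons_zero]
          rfl
      _ = ∏ i, ∫⁻ x, f i x ∂(ν i) := by
          rw [lintegral_prod_mul (hf 0) htail, ih (fun i => ν i.succ) fun i => hf i.succ,
            Fin.prod_univ_succ]

lemma pi_withDensity_eq {n : ℕ} {E : Type*} [MeasurableSpace E] (ν : Measure E) [SigmaFinite ν]
    {f : E → ℝ≥0∞} (hf : AEMeasurable f ν) [SigmaFinite (ν.withDensity f)] :
    Measure.pi (fun _ : Fin n => ν.withDensity f) =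
      (Measure.pi fun _ : Fin n => ν).withDensity fun x => ∏ i, f (x i) := by
  refine Measure.pi_eq fun s hs => ?_
  rw [withDensity_apply _ (MeasurableSet.univ_pi hs), Measure.restrict_pi_pi,
    lintegral_prod_pi (fun i => ν.restrict (s i)) (f := fun _ => f) fun i => hf.restrict]
  exact Finset.prod_congr rfl fun i _ => (withDensity_apply _ (hs i)).symm

lemma measurable_pi_kernel {n : ℕ} {Θ E : Type*} [MeasurableSpace Θ] [MeasurableSpace E]
    (μ : Kernel Θ E) [IsMarkovKernel μ] :
    Measurable fun θ => Measure.pi fun _ : Fin n => μ θ := by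
  refine Measurable.measure_of_isPiSystem_of_isProbabilityMeasure generateFrom_pi.symm
    isPiSystem_pi ?_
  rintro _ ⟨t, ht, rfl⟩
  simp_rw [Measure.pi_pi]
  exact Finset.measurable_fun_prod _ fun i _ => Kernel.measurable_coe μ (ht i (Set.mem_univ i))

end Product

/-! ### Reweighted priors -/

lemma isProbabilityMeasure_reweight {Θ : Type*} [MeasurableSpace Θ] {π : Measure Θ}
    {w : Θ → ℝ≥0∞} (h0 : ∫⁻ θ, w θ ∂π ≠ 0) (ht : ∫⁻ θ, w θ ∂π ≠ ∞) :
    IsProbabilityMeasure (reweight π w) := by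
  constructor
  rw [reweight, Measure.smul_apply, withDensity_apply _ MeasurableSet.univ,
    Measure.restrict_univ, smul_eq_mul, ENNReal.inv_mul_cancel h0 ht]

lemma reweight_apply {Θ : Type*} [MeasurableSpace Θ] (π : Measure Θ)
    (w : Θ → ℝ≥0∞) {B : Set Θ} (hB : MeasurableSet B) :
    reweight π w B = (∫⁻ θ, w θ ∂π)⁻¹ * ∫⁻ θ in B, w θ ∂π := by
  rw [reweight, Measure.smul_apply, withDensity_apply _ hB, smul_eq_mul]

lemma reweight_const_mul {Θ : Type*} [MeasurableSpace Θ] (π : Measure Θ)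
    (w : Θ → ℝ≥0∞) {c : ℝ≥0∞} (h0 : c ≠ 0) (ht : c ≠ ∞) {B : Set Θ} (hB : MeasurableSet B) :
    reweight π (fun θ => c * w θ) B = reweight π w B := by
  rw [reweight_apply _ _ hB, reweight_apply _ _ hB, lintegral_const_mul' _ _ ht,
    lintegral_const_mul' _ _ ht, ENNReal.mul_inv (Or.inl h0) (Or.inl ht), mul_mul_mul_comm,
    ENNReal.inv_mul_cancel h0 ht, one_mul]

/-! ### Volume of acceptance sets and averages of the likelihood -/

section Accept

variable {d n : ℕ} {Y : Set (EuclideanSpace ℝ (Fin d))}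

/-- The data sets within Sliced-Wasserstein distance `ε` of `y`. -/
def acceptSet (p : ℝ) (y : Fin n → EuclideanSpace ℝ (Fin d)) (ε : ℝ) :
    Set (Fin n → EuclideanSpace ℝ (Fin d)) :=
  {z | dataSW p y z ≤ ENNReal.ofReal ε}

/-- Lebesgue measure on `Y ^ n`. -/
noncomputable def dataVolume (n : ℕ) (Y : Set (EuclideanSpace ℝ (Fin d))) :
    Measure (Fin n → EuclideanSpace ℝ (Fin d)) :=
  Measure.pi fun _ => volume.restrict Y

lemma measurableSet_acceptSet (hn : 1 ≤ n) {p : ℝ} (hp : 1 ≤ p)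
    (y : Fin n → EuclideanSpace ℝ (Fin d)) (ε : ℝ) : MeasurableSet (acceptSet p y ε) :=
  measurable_dataSW hn hp y measurableSet_Iic

lemma ae_dataVolume (n : ℕ) (hY : MeasurableSet Y) :
    ∀ᵐ z ∂(dataVolume n Y), ∀ i, z i ∈ Y := by
  rw [dataVolume, ← Measure.restrict_pi_pi]
  filter_upwards [ae_restrict_mem (MeasurableSet.univ_pi fun _ => hY)] with z hz i
  exact hz i (Set.mem_univ i)

lemma dataVolume_acceptSet_ne_zero (hn : 1 ≤ n) {p : ℝ} (hp : 1 ≤ p)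
    {y : Fin n → EuclideanSpace ℝ (Fin d)}
    (hy : ∀ i, ∀ r > 0, 0 < volume (Metric.ball (y i) r ∩ Y)) {ε : ℝ} (hε : 0 < ε) :
    dataVolume n Y (acceptSet p y ε) ≠ 0 := by
  -- A product of balls of positive measure is accepted, through the identity matching.
  have hsub : Set.univ.pi (fun i => Metric.ball (y i) ε) ⊆ acceptSet p y ε := fun z hz =>
    dataSW_le_of_forall_dist_le hn hp fun i => (hz i (Set.mem_univ i)).le
  refine (lt_of_lt_of_le ?_ (measure_mono hsub)).ne'
  rw [dataVolume, Measure.pi_pi]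
  refine pos_iff_ne_zero.2 (Finset.prod_ne_zero_iff.2 fun i _ => ?_)
  rw [Measure.restrict_apply measurableSet_ball]
  exact (hy i ε hε).ne'

lemma exists_dataVolume_acceptSet_ne_top (hd : 1 ≤ d) (hn : 1 ≤ n) {p : ℝ} (hp : 1 ≤ p)
    (y : Fin n → EuclideanSpace ℝ (Fin d)) :
    ∃ ε > (0 : ℝ), dataVolume n Y (acceptSet p y ε) ≠ ∞ := by
  obtain ⟨ε, hε, h⟩ := exists_forall_dataSW_le_imp_dist_lt hd hn hp y one_pos
  refine ⟨ε, hε, ?_⟩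
  -- Up to relabelling, accepted data lie within 1 of `y`: finitely many products of unit balls
  -- cover them.
  have hsub : acceptSet p y ε ⊆ ⋃ τ : Equiv.Perm (Fin n),
      Set.univ.pi fun i => Metric.ball (y (τ.symm i)) 1 := by
    intro z hz
    obtain ⟨τ, hτ⟩ := h z hz
    refine Set.mem_iUnion.2 ⟨τ, fun i _ => ?_⟩
    simpa using hτ (τ.symm i)
  refine ne_top_of_le_ne_top ?_ ((measure_mono hsub).trans (measure_iUnion_fintype_le _ _))
  refine ENNReal.sum_ne_top.2 fun τ _ => ?_
  rw [dataVolume, Measure.pi_pi]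
  exact ENNReal.prod_ne_top fun i _ =>
    ((Measure.restrict_apply_le _ _).trans_lt measure_ball_lt_top).ne

lemma acceptSet_mono (p : ℝ) (y : Fin n → EuclideanSpace ℝ (Fin d)) {ε ε' : ℝ} (h : ε ≤ ε') :
    acceptSet p y ε ⊆ acceptSet p y ε' := fun _ hz =>
  le_trans (Set.mem_ofPred.1 hz) (ENNReal.ofReal_le_ofReal h)

lemma likelihood_comp_perm {Θ : Type*} (f : Θ → EuclideanSpace ℝ (Fin d) → ℝ≥0)
    (z : Fin n → EuclideanSpace ℝ (Fin d)) (θ : Θ) (τ : Equiv.Perm (Fin n)) :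
    likelihood f (fun i => z (τ i)) θ = likelihood f z θ :=
  Equiv.prod_comp τ fun i => f θ (z i)

/-- The likelihood is continuous at the observed data with respect to the Sliced-Wasserstein
distance. -/
lemma eventually_likelihood_mem (hd : 1 ≤ d) (hn : 1 ≤ n) {p : ℝ} (hp : 1 ≤ p) {Θ : Type*}
    {f : Θ → EuclideanSpace ℝ (Fin d) → ℝ≥0} {θ : Θ}
    (hf : ContinuousOn (f θ) Y) {y : Fin n → EuclideanSpace ℝ (Fin d)} (hyY : ∀ i, y i ∈ Y)
    {U : Set ℝ≥0∞} (hU : U ∈ 𝓝 (likelihood f y θ : ℝ≥0∞)) :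
    ∀ᶠ ε in 𝓝[>] (0 : ℝ), ∀ z, (∀ i, z i ∈ Y) → dataSW p y z ≤ ENNReal.ofReal ε →
      (likelihood f z θ : ℝ≥0∞) ∈ U := by
  have hL : ContinuousOn (fun z => (likelihood f z θ : ℝ≥0∞))
      (Set.univ.pi fun _ : Fin n => Y) := by
    refine ENNReal.continuous_coe.comp_continuousOn (continuousOn_finsetProd _ fun i _ => ?_)
    exact hf.comp (continuous_apply i).continuousOn fun z hz => hz i (Set.mem_univ i)
  have hy' : y ∈ Set.univ.pi fun _ : Fin n => Y := fun i _ => hyY i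
  obtain ⟨r, hr, hrU⟩ := Metric.mem_nhdsWithin_iff.1 ((hL y hy') hU)
  obtain ⟨ε₀, hε₀, h⟩ := exists_forall_dataSW_le_imp_dist_lt hd hn hp y hr
  filter_upwards [Ioo_mem_nhdsGT hε₀] with ε hε z hz hzε
  obtain ⟨τ, hτ⟩ := h z (hzε.trans (ENNReal.ofReal_le_ofReal hε.2.le))
  -- Only the permuted data set is near `y`, but it has the same likelihood as `z`.
  rw [← likelihood_comp_perm f z θ τ]
  exact hrU ⟨(dist_pi_lt_iff hr).2 hτ, fun i _ => hz _⟩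

variable {Θ : Type*} [MeasurableSpace Θ]
  {μ : Kernel Θ (EuclideanSpace ℝ (Fin d))} [IsMarkovKernel μ]
  {f : Θ → EuclideanSpace ℝ (Fin d) → ℝ≥0}

lemma measurable_acceptProb (hn : 1 ≤ n) {p : ℝ} (hp : 1 ≤ p)
    (y : Fin n → EuclideanSpace ℝ (Fin d)) (ε : ℝ) : Measurable (acceptProb μ p y ε) :=
  (Measure.measurable_coe (measurableSet_acceptSet hn hp y ε)).comp (measurable_pi_kernel μ)

lemma acceptProb_eq_lintegral (hn : 1 ≤ n) (hY : MeasurableSet Y)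
    (hμ : ∀ θ, μ θ = (volume.restrict Y).withDensity (fun x => (f θ x : ℝ≥0∞)))
    (hf : ∀ θ, ContinuousOn (f θ) Y) {p : ℝ} (hp : 1 ≤ p)
    (y : Fin n → EuclideanSpace ℝ (Fin d)) (ε : ℝ) (θ : Θ) :
    acceptProb μ p y ε θ =
      ∫⁻ z in acceptSet p y ε, (likelihood f z θ : ℝ≥0∞) ∂(dataVolume n Y) := by
  -- Off `Y` nothing is known about `f θ`, so measurability holds only relative to the restricted
  -- measure.
  have hm : AEMeasurable (fun x => (f θ x : ℝ≥0∞)) (volume.restrict Y) :=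
    ((hf θ).aemeasurable hY).coe_nnreal_ennreal
  have : SigmaFinite ((volume.restrict Y).withDensity (fun x => (f θ x : ℝ≥0∞))) :=
    hμ θ ▸ inferInstance
  have h1 : acceptProb μ p y ε θ =
      Measure.pi (fun _ : Fin n => (volume.restrict Y).withDensity fun x => (f θ x : ℝ≥0∞))
        (acceptSet p y ε) := by
    rw [← hμ θ]; rfl
  rw [h1, pi_withDensity_eq _ hm, withDensity_apply _ (measurableSet_acceptSet hn hp y ε)]
  simp only [likelihood, ENNReal.ofNNReal_finsetProd]
  rfl

lemma acceptProb_le_mul (hn : 1 ≤ n) (hY : MeasurableSet Y)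
    (hμ : ∀ θ, μ θ = (volume.restrict Y).withDensity (fun x => (f θ x : ℝ≥0∞)))
    (hf : ∀ θ, ContinuousOn (f θ) Y) {p : ℝ} (hp : 1 ≤ p)
    {y : Fin n → EuclideanSpace ℝ (Fin d)} {ε : ℝ} {θ : Θ} {C : ℝ≥0∞}
    (h : ∀ z, (∀ i, z i ∈ Y) → dataSW p y z ≤ ENNReal.ofReal ε →
      (likelihood f z θ : ℝ≥0∞) ≤ C) :
    acceptProb μ p y ε θ ≤ C * dataVolume n Y (acceptSet p y ε) := by
  rw [acceptProb_eq_lintegral hn hY hμ hf hp, ← setLIntegral_const]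
  refine lintegral_mono_ae ?_
  filter_upwards [ae_restrict_of_ae (ae_dataVolume n hY),
    ae_restrict_mem (measurableSet_acceptSet hn hp y ε)] with z hz hzA
  exact h z hz hzA

lemma mul_le_acceptProb (hn : 1 ≤ n) (hY : MeasurableSet Y)
    (hμ : ∀ θ, μ θ = (volume.restrict Y).withDensity (fun x => (f θ x : ℝ≥0∞)))
    (hf : ∀ θ, ContinuousOn (f θ) Y) {p : ℝ} (hp : 1 ≤ p)
    {y : Fin n → EuclideanSpace ℝ (Fin d)} {ε : ℝ} {θ : Θ} {C : ℝ≥0∞}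
    (h : ∀ z, (∀ i, z i ∈ Y) → dataSW p y z ≤ ENNReal.ofReal ε →
      C ≤ (likelihood f z θ : ℝ≥0∞)) :
    C * dataVolume n Y (acceptSet p y ε) ≤ acceptProb μ p y ε θ := by
  rw [acceptProb_eq_lintegral hn hY hμ hf hp, ← setLIntegral_const]
  refine lintegral_mono_ae ?_
  filter_upwards [ae_restrict_of_ae (ae_dataVolume n hY),
    ae_restrict_mem (measurableSet_acceptSet hn hp y ε)] with z hz hzA
  exact h z hz hzA

/-- Once the likelihood is within `δ` of its value at `y` on all accepted data in `Y ^ n`, so is its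
average. -/
lemma tendsto_acceptProb (hd : 1 ≤ d) (hn : 1 ≤ n) (hY : MeasurableSet Y)
    (hμ : ∀ θ, μ θ = (volume.restrict Y).withDensity (fun x => (f θ x : ℝ≥0∞)))
    (hf : ∀ θ, ContinuousOn (f θ) Y) {p : ℝ} (hp : 1 ≤ p)
    {y : Fin n → EuclideanSpace ℝ (Fin d)} (hyY : ∀ i, y i ∈ Y)
    (hV : ∀ᶠ ε in 𝓝[>] (0 : ℝ), dataVolume n Y (acceptSet p y ε) ≠ 0 ∧
      dataVolume n Y (acceptSet p y ε) ≠ ∞) (θ : Θ) :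
    Tendsto (fun ε => (dataVolume n Y (acceptSet p y ε))⁻¹ * acceptProb μ p y ε θ) (𝓝[>] 0)
      (𝓝 (likelihood f y θ : ℝ≥0∞)) := by
  refine (ENNReal.tendsto_nhds ENNReal.coe_ne_top).2 fun δ hδ => ?_
  filter_upwards [hV, eventually_likelihood_mem hd hn hp (hf θ) hyY
    (ENNReal.Icc_mem_nhds ENNReal.coe_ne_top hδ.ne')] with ε hVε hε
  rw [mul_comm, ← div_eq_mul_inv]
  constructor
  · rw [ENNReal.le_div_iff_mul_le (Or.inl hVε.1) (Or.inl hVε.2)]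
    exact mul_le_acceptProb hn hY hμ hf hp fun z hz hzε => (hε z hz hzε).1
  · rw [ENNReal.div_le_iff hVε.1 hVε.2]
    exact acceptProb_le_mul hn hY hμ hf hp fun z hz hzε => (hε z hz hzε).2

end Accept

end SWABC

/-! ### The posterior limit -/

theorem proposition1 {d n : ℕ} (hd : 1 ≤ d) (hn : 1 ≤ n)
    -- the data space, a closed (that is, complete) subset of Euclidean space
    (Y : Set (EuclideanSpace ℝ (Fin d))) (hY : IsClosed Y)
    -- the parameter space, the prior and the statistical model
    {Θ : Type*} [MeasurableSpace Θ] (π : Measure Θ) [IsProbabilityMeasure π]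
    (μ : Kernel Θ (EuclideanSpace ℝ (Fin d))) [IsMarkovKernel μ]
    -- a continuous density of each `μ θ` with respect to Lebesgue measure on `Y`
    (f : Θ → EuclideanSpace ℝ (Fin d) → ℝ≥0)
    (hμ : ∀ θ, μ θ = (volume.restrict Y).withDensity (fun x => (f θ x : ℝ≥0∞)))
    (hf : ∀ θ, ContinuousOn (f θ) Y)
    (p : ℝ) (hp : 1 ≤ p)
    -- the observed data, points of `Y` near which `Y` is not Lebesgue-null
    (y : Fin n → EuclideanSpace ℝ (Fin d)) (hyY : ∀ i, y i ∈ Y)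
    (hy : ∀ i, ∀ r > 0, 0 < volume (Metric.ball (y i) r ∩ Y))
    -- the exact posterior is defined
    (hev : ∫⁻ θ, (SWABC.likelihood f y θ : ℝ≥0∞) ∂π ≠ 0)
    -- the prior-null set and the two uniform bounds
    (N : Set Θ) (hN : π N = 0)
    (hbdd : BddAbove {t : ℝ≥0 | ∃ θ ∉ N, t = SWABC.likelihood f y θ})
    (hbddA : ∃ ε' > (0 : ℝ), BddAbove {t : ℝ≥0 | ∃ θ ∉ N, ∃ z : Fin n → EuclideanSpace ℝ (Fin d),
      (∀ i, z i ∈ Y) ∧ SWABC.dataSW p y z ≤ ENNReal.ofReal ε' ∧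
        t = SWABC.likelihood f z θ}) :
    IsProbabilityMeasure (SWABC.exactPosterior π f y) ∧
    (∀ ε > 0, IsProbabilityMeasure (SWABC.swAbcPosterior π μ p y ε)) ∧
    ∀ B : Set Θ, MeasurableSet B →
      Tendsto (fun ε : ℝ => SWABC.swAbcPosterior π μ p y ε B) (𝓝[>] 0)
        (𝓝 (SWABC.exactPosterior π f y B)) := by
  have hYm : MeasurableSet Y := hY.measurableSet
  have hNae : ∀ᵐ θ ∂π, θ ∉ N := measure_eq_zero_iff_ae_notMem.1 hN
  obtain ⟨ε₀, hε₀, hV₀⟩ := SWABC.exists_dataVolume_acceptSet_ne_top (Y := Y) hd hn hp y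
  have hV : ∀ᶠ ε in 𝓝[>] (0 : ℝ), SWABC.dataVolume n Y (SWABC.acceptSet p y ε) ≠ 0 ∧
      SWABC.dataVolume n Y (SWABC.acceptSet p y ε) ≠ ∞ := by
    filter_upwards [Ioo_mem_nhdsGT hε₀] with ε hε
    exact ⟨SWABC.dataVolume_acceptSet_ne_zero hn hp hy hε.1,
      ne_top_of_le_ne_top hV₀ (measure_mono (SWABC.acceptSet_mono p y hε.2.le))⟩
  have hlim := SWABC.tendsto_acceptProb hd hn hYm hμ hf hp hyY hV
  obtain ⟨K, hK⟩ := hbdd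
  have hfin : ∫⁻ θ, (SWABC.likelihood f y θ : ℝ≥0∞) ∂π ≠ ∞ := by
    refine ne_top_of_le_ne_top (ENNReal.coe_ne_top (r := K)) ?_
    calc _ ≤ ∫⁻ _, (K : ℝ≥0∞) ∂π := by
          refine lintegral_mono_ae ?_
          filter_upwards [hNae] with θ hθ
          exact ENNReal.coe_le_coe.2 (hK ⟨θ, hθ, rfl⟩)
      _ = K := by simp
  refine ⟨SWABC.isProbabilityMeasure_reweight hev hfin, fun ε hε => ?_, fun B hB => ?_⟩
  · refine SWABC.isProbabilityMeasure_reweight (fun h0 => hev ?_) ?_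
    -- If acceptance had probability zero at `ε` for almost every `θ`, it would for all smaller
    -- tolerances too; the limit, the likelihood of `y`, would vanish a.e., against `hev`.
    · rw [lintegral_eq_zero_iff (SWABC.measurable_acceptProb hn hp y ε)] at h0
      refine (lintegral_congr_ae ?_).trans lintegral_zero
      filter_upwards [h0] with θ hθ
      refine tendsto_nhds_unique_of_eventuallyEq (hlim θ) tendsto_const_nhds ?_
      filter_upwards [Ioo_mem_nhdsGT hε] with ε' hε'
      have : SWABC.acceptProb μ p y ε' θ = 0 :=
        le_antisymm ((measure_mono (SWABC.acceptSet_mono p y hε'.2.le)).trans hθ.le) zero_le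
      rw [this, mul_zero]
    · refine ne_top_of_le_ne_top ENNReal.one_ne_top ?_
      calc _ ≤ ∫⁻ _, (1 : ℝ≥0∞) ∂π := lintegral_mono fun θ => prob_le_one
        _ = 1 := by simp
  · obtain ⟨ε', hε', M, hM⟩ := hbddA
    have hdom : ∀ᶠ ε in 𝓝[>] (0 : ℝ), ∀ᵐ θ ∂π,
        (SWABC.dataVolume n Y (SWABC.acceptSet p y ε))⁻¹ * SWABC.acceptProb μ p y ε θ ≤ M := by
      filter_upwards [hV, Ioo_mem_nhdsGT hε'] with ε hVε hε
      filter_upwards [hNae] with θ hθ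
      rw [mul_comm, ← div_eq_mul_inv, ENNReal.div_le_iff hVε.1 hVε.2]
      exact SWABC.acceptProb_le_mul hn hYm hμ hf hp fun z hz hzε => ENNReal.coe_le_coe.2
        (hM ⟨θ, hθ, z, hz, hzε.trans (ENNReal.ofReal_le_ofReal hε.2.le), rfl⟩)
    have hint : ∀ S : Set Θ, Tendsto (fun ε => ∫⁻ θ in S,
        (SWABC.dataVolume n Y (SWABC.acceptSet p y ε))⁻¹ * SWABC.acceptProb μ p y ε θ ∂π)
        (𝓝[>] 0) (𝓝 (∫⁻ θ in S, (SWABC.likelihood f y θ : ℝ≥0∞) ∂π)) := fun S =>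
      tendsto_lintegral_filter_of_dominated_convergence (fun _ => (M : ℝ≥0∞))
        (Eventually.of_forall fun ε => (SWABC.measurable_acceptProb hn hp y ε).const_mul _)
        (hdom.mono fun ε h => ae_restrict_of_ae h)
        (by rw [setLIntegral_const]; exact ENNReal.mul_ne_top ENNReal.coe_ne_top (measure_ne_top _ _))
        (Eventually.of_forall hlim)
    have huniv := hint Set.univ
    simp only [Measure.restrict_univ] at huniv
    rw [SWABC.exactPosterior, SWABC.reweight_apply _ _ hB]
    -- Normalizing by the volume leaves the posterior unchanged once this volume is positive and
    -- finite.
    refine Tendsto.congr' (f₁ := fun ε => SWABC.reweight π (fun θ =>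
      (SWABC.dataVolume n Y (SWABC.acceptSet p y ε))⁻¹ * SWABC.acceptProb μ p y ε θ) B) ?_ ?_
    · filter_upwards [hV] with ε hε
      exact SWABC.reweight_const_mul π _ (ENNReal.inv_ne_zero.2 hε.2)
        (ENNReal.inv_ne_top.2 hε.1) hB
    · simp only [SWABC.reweight_apply _ _ hB]
      exact ENNReal.Tendsto.mul (tendsto_inv_iff.2 huniv)
        (Or.inl (ENNReal.inv_ne_zero.2 hfin)) (hint B) (Or.inr (ENNReal.inv_ne_top.2 hev))
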